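/- For a path-connected metrizable space $X$ and $x\in X$, call a subgroup $G\le \pi_1(X,x)$ closed if the set of all loops at $x$ whose homotopy class lies in $G$ is closed in the space of loops at $x$ with the topology of uniform convergence. The strong abelianization $h(X)$ is the quotient of $\pi_1(X,x)$ by the smallest closed subgroup containing the commutator subgroup $[\pi_1(X,x),\pi_1(X,x)]$; up to isomorphism it does not depend on the base point $x$. Let $(X_n,x_n)_{n\in\omega}$ be pointed metrizable spaces, and for each $n$ let $d_n$ be a metric inducing the topology of $X_n$ with $\operatorname{diam}(X_n)\le 2^{-n}$. The shrinking wedge $\bigvee^s_{n\in\omega}(X_n,x_n)$ is the disjoint union of the $X_n$ with all the points $x_n$ identified, topologized by the metric $d(y,z)=d_n(y,z)$ if $y,z\in X_n$, and $d(y,z)=d_n(y,x_n)+d_m(z,x_m)$ if $y\in X_n\setminus\{x_n\}$, $z\in X_m\setminus\{x_m\}$ with $m\ne n$. **Theorem.** If every $X_n$ is path connected, then for every choice of such metrics $d_n$ (and whichever base points are used to compute the strong abelianizations) there is a group isomorphism $$h\Bigl(\bigvee^s_{n\in\omega}(X_n,x_n)\Bigr)\;\cong\;\prod_{n\in\omega}h(X_n).$$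 For example, the Hawaiian earring $E=\bigcup_{n\in\omega}C\bigl((0,\tfrac1{n+2}),\tfrac1{n+2}\bigr)\subseteq\mathbb R^2$, where $C(p,r)$ is the circle with centre $p$ and radius $r$, satisfies $h(E)\cong\prod_{n\in\omega}\mathbb Z$. -/

import Mathlib

open Topology

universe u

noncomputable section

namespace StrongAb

section StrongAbelianization

variable {X : Type u} [TopologicalSpace X] {x : X}

/-- The set `⋃ G` of all loops at `x` whose homotopy class belongs to the subgroup `G`
of the fundamental group. -/
def loopsOf (G : Subgroup (FundamentalGroup X x)) : Set (Path x x) :=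
  {l | FundamentalGroup.fromPath (Path.Homotopic.Quotient.mk l) ∈ G}

/-- A subgroup of `π₁(X, x)` is closed if its set of loops is closed in the loop space at `x`.
The loop space `Path x x` carries the compact-open topology, which is the topology of the
metric `sup_s d(l₀ s, l₁ s)` for every metric `d` inducing the topology of `X`. -/
def IsClosedSubgroup (G : Subgroup (FundamentalGroup X x)) : Prop :=
  IsClosed (loopsOf G)

/-- The smallest closed subgroup containing `G`. -/
def closedHull (G : Subgroup (FundamentalGroup X x)) : Subgroup (FundamentalGroup X x) :=
  sInf {H | G ≤ H ∧ IsClosedSubgroup H}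

theorem le_closedHull (G : Subgroup (FundamentalGroup X x)) : G ≤ closedHull G :=
  le_sInf fun _ hH => hH.1

theorem isClosedSubgroup_closedHull (G : Subgroup (FundamentalGroup X x)) :
    IsClosedSubgroup (closedHull G) := by
  have h : loopsOf (closedHull G) =
      ⋂ H ∈ {H : Subgroup (FundamentalGroup X x) | G ≤ H ∧ IsClosedSubgroup H}, loopsOf H := by
    ext l
    simp only [loopsOf, closedHull, Subgroup.mem_sInf, Set.mem_ofPred_eq, Set.mem_iInter]
  unfold IsClosedSubgroup
  rw [h]
  exact isClosed_biInter fun H hH => hH.2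

theorem closedHull_le {G H : Subgroup (FundamentalGroup X x)} (hGH : G ≤ H)
    (hH : IsClosedSubgroup H) : closedHull G ≤ H :=
  sInf_le ⟨hGH, hH⟩

variable (X x)

/-- The smallest closed subgroup of `π₁(X, x)` containing the commutator subgroup. -/
def closedCommutator : Subgroup (FundamentalGroup X x) :=
  closedHull (commutator (FundamentalGroup X x))

instance closedCommutator_normal : (closedCommutator X x).Normal where
  conj_mem n hn g := by
    have h : g * n * g⁻¹ * n⁻¹ ∈ closedCommutator X x :=
      le_closedHull _ (Subgroup.commutator_mem_commutator (Subgroup.mem_top g)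
        (Subgroup.mem_top n))
    have h2 := mul_mem h hn
    rwa [inv_mul_cancel_right] at h2

/-- The strong abelianization of `X`, computed at the base point `x`: the quotient of `π₁(X, x)`
by the smallest closed subgroup containing its commutator subgroup. -/
abbrev StrongAbelianization : Type u :=
  FundamentalGroup X x ⧸ closedCommutator X x

end StrongAbelianization

section Wedge

/-- A metric on `Y` that induces the given topology of `Y` and for which `Y` has diameter at
most `2⁻ⁿ`. -/
structure CutoffMetric (Y : Type u) [t : TopologicalSpace Y] (n : ℕ) where
  metric : MetricSpace Y
  topology_eq : metric.toPseudoMetricSpace.toUniformSpace.toTopologicalSpace = t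
  dist_le : ∀ y z : Y, metric.dist y z ≤ (2 : ℝ)⁻¹ ^ n

variable {X : ℕ → Type u} [∀ n, TopologicalSpace (X n)]

/-- Every metrizable space has such a metric, namely a cutoff metric `min d 2⁻ⁿ`. -/
theorem nonempty_cutoffMetric (Y : Type u) [t : TopologicalSpace Y]
    [TopologicalSpace.MetrizableSpace Y] (n : ℕ) : Nonempty (CutoffMetric Y n) := by
  let _ := TopologicalSpace.metrizableSpaceMetric Y
  have hr : (0 : ℝ) < (2 : ℝ)⁻¹ ^ n := by positivity
  refine ⟨⟨MetricSpace.ofDistTopology (fun y z => min (dist y z) ((2 : ℝ)⁻¹ ^ n)) ?_ ?_ ?_ ?_ ?_,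
    ?_, ?_⟩⟩
  · intro y; simp
  · intro y z; simp only [dist_comm]
  · intro y z w
    have h1 := dist_triangle y z w
    have h2 : 0 ≤ dist y z := dist_nonneg
    have h3 : 0 ≤ dist z w := dist_nonneg
    simp only [min_def]
    split_ifs <;> linarith
  · intro s
    rw [Metric.isOpen_iff]
    refine forall₂_congr fun y _ => ⟨?_, ?_⟩
    · rintro ⟨ε, hε, h⟩
      refine ⟨min ε ((2 : ℝ)⁻¹ ^ n), lt_min hε hr, fun z hz => h ?_⟩
      rw [Metric.mem_ball, dist_comm]
      rcases min_lt_iff.1 hz with h' | h'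
      · exact h'.trans_le (min_le_left _ _)
      · exact absurd h' (not_lt.2 (min_le_right _ _))
    · rintro ⟨ε, hε, h⟩
      refine ⟨ε, hε, fun z hz => h z ?_⟩
      rw [Metric.mem_ball, dist_comm] at hz
      exact (min_le_left _ _).trans_lt hz
  · intro y z h
    rcases min_choice (dist y z) ((2 : ℝ)⁻¹ ^ n) with h' | h'
    · exact dist_eq_zero.1 (h' ▸ h)
    · exact absurd (h'.symm.trans h) hr.ne'
  · rfl
  · intro y z; exact min_le_right _ _

variable (x : ∀ n, X n)

/-- The identification of all the points `x n` in the disjoint union of the spaces `X n`. -/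
def wedgeSetoid : Setoid (Σ n, X n) where
  r a b := a = b ∨ (a.2 = x a.1 ∧ b.2 = x b.1)
  iseqv :=
    { refl := fun _ => Or.inl rfl
      symm := by
        rintro a b (h | h)
        · exact Or.inl h.symm
        · exact Or.inr ⟨h.2, h.1⟩
      trans := by
        rintro a b c (rfl | h) (rfl | h')
        · exact Or.inl rfl
        · exact Or.inr h'
        · exact Or.inr h
        · exact Or.inr ⟨h.1, h'.2⟩ }

variable (d : ∀ n, CutoffMetric (X n) n)

/-- The shrinking wedge of the pointed spaces `(X n, x n)`: the disjoint union of the `X n` with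
all the points `x n` identified, with the metric defined below from the metrics `d n`. -/
def ShrinkingWedge (_d : ∀ n, CutoffMetric (X n) n) : Type u :=
  Quotient (wedgeSetoid x)

/-- The distance is `d n y z` for `y`, `z` in the same `X n`, and is
`d n y (x n) + d m z (x m)` for `y` in `X n` and `z` in `X m` with `n ≠ m`. -/
def sigmaDist (a b : Σ n, X n) : ℝ :=
  if h : b.1 = a.1 then (d a.1).metric.dist a.2 (h ▸ b.2)
  else (d a.1).metric.dist a.2 (x a.1) + (d b.1).metric.dist b.2 (x b.1)

theorem sigmaDist_same (n : ℕ) (y z : X n) :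
    sigmaDist x d ⟨n, y⟩ ⟨n, z⟩ = (d n).metric.dist y z := by
  simp [sigmaDist]

theorem sigmaDist_ne {n m : ℕ} (hnm : n ≠ m) (y : X n) (z : X m) :
    sigmaDist x d ⟨n, y⟩ ⟨m, z⟩ = (d n).metric.dist y (x n) + (d m).metric.dist z (x m) := by
  simp [sigmaDist, hnm.symm]

theorem cutoff_dist_self {n : ℕ} (y : X n) : (d n).metric.dist y y = 0 :=
  (d n).metric.dist_self y

theorem cutoff_dist_comm {n : ℕ} (y z : X n) : (d n).metric.dist y z = (d n).metric.dist z y :=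
  (d n).metric.dist_comm y z

theorem cutoff_dist_triangle {n : ℕ} (y z w : X n) :
    (d n).metric.dist y w ≤ (d n).metric.dist y z + (d n).metric.dist z w :=
  (d n).metric.dist_triangle y z w

theorem cutoff_dist_nonneg {n : ℕ} (y z : X n) : 0 ≤ (d n).metric.dist y z :=
  let _ := (d n).metric
  dist_nonneg

theorem cutoff_eq_of_dist {n : ℕ} {y z : X n} (h : (d n).metric.dist y z = 0) : y = z :=
  (d n).metric.eq_of_dist_eq_zero h

theorem sigmaDist_comm (a b : Σ n, X n) : sigmaDist x d a b = sigmaDist x d b a := by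
  obtain ⟨n, y⟩ := a
  obtain ⟨m, z⟩ := b
  by_cases h : n = m
  · subst h; simp only [sigmaDist_same, cutoff_dist_comm]
  · rw [sigmaDist_ne x d h, sigmaDist_ne x d (Ne.symm h), add_comm]

theorem sigmaDist_base (n : ℕ) (b : Σ n, X n) :
    sigmaDist x d ⟨n, x n⟩ b = (d b.1).metric.dist b.2 (x b.1) := by
  obtain ⟨m, z⟩ := b
  by_cases h : n = m
  · subst h; rw [sigmaDist_same, cutoff_dist_comm]
  · rw [sigmaDist_ne x d h, cutoff_dist_self, zero_add]

theorem sigmaDist_congr_left {a a' : Σ n, X n} (h : (wedgeSetoid x).r a a') (b : Σ n, X n) :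
    sigmaDist x d a b = sigmaDist x d a' b := by
  rcases h with rfl | ⟨h, h'⟩
  · rfl
  · obtain ⟨n, y⟩ := a
    obtain ⟨m, z⟩ := a'
    simp only at h h'
    subst h h'
    rw [sigmaDist_base, sigmaDist_base]

theorem sigmaDist_triangle (a b c : Σ n, X n) :
    sigmaDist x d a c ≤ sigmaDist x d a b + sigmaDist x d b c := by
  obtain ⟨n, y⟩ := a
  obtain ⟨m, z⟩ := b
  obtain ⟨k, w⟩ := c
  by_cases h1 : n = m <;> by_cases h2 : m = k
  · subst h1 h2; simp only [sigmaDist_same]; exact cutoff_dist_triangle d _ _ _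
  · subst h1
    rw [sigmaDist_same, sigmaDist_ne x d h2, sigmaDist_ne x d h2]
    have := cutoff_dist_triangle d y z (x n)
    linarith
  · subst h2
    rw [sigmaDist_same, sigmaDist_ne x d h1, sigmaDist_ne x d h1]
    have := cutoff_dist_triangle d w z (x m)
    rw [cutoff_dist_comm d w z] at this
    linarith
  · have hz := cutoff_dist_nonneg d z (x m)
    rw [sigmaDist_ne x d h1, sigmaDist_ne x d h2]
    by_cases h3 : n = k
    · subst h3
      rw [sigmaDist_same]
      have := cutoff_dist_triangle d y (x n) w
      rw [cutoff_dist_comm d (x n) w] at this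
      linarith
    · rw [sigmaDist_ne x d h3]
      linarith

theorem rel_of_sigmaDist_eq_zero {a b : Σ n, X n} (h : sigmaDist x d a b = 0) :
    (wedgeSetoid x).r a b := by
  obtain ⟨n, y⟩ := a
  obtain ⟨m, z⟩ := b
  by_cases h1 : n = m
  · subst h1
    rw [sigmaDist_same] at h
    exact Or.inl (by rw [cutoff_eq_of_dist d h])
  · rw [sigmaDist_ne x d h1] at h
    have hy := cutoff_dist_nonneg d y (x n)
    have hz := cutoff_dist_nonneg d z (x m)
    exact Or.inr ⟨cutoff_eq_of_dist d (by linarith), cutoff_eq_of_dist d (by linarith)⟩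

instance : MetricSpace (ShrinkingWedge x d) where
  dist := Quotient.lift₂ (s₁ := wedgeSetoid x) (s₂ := wedgeSetoid x) (sigmaDist x d)
    (fun a b a' b' h h' => by
      rw [sigmaDist_congr_left x d h b, sigmaDist_comm, sigmaDist_congr_left x d h' a',
        sigmaDist_comm])
  dist_self := by
    rintro ⟨n, y⟩
    exact (sigmaDist_same x d n y y).trans (cutoff_dist_self d y)
  dist_comm := by
    rintro ⟨a⟩ ⟨b⟩
    exact sigmaDist_comm x d a b
  dist_triangle := by
    rintro ⟨a⟩ ⟨b⟩ ⟨c⟩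
    exact sigmaDist_triangle x d a b c
  eq_of_dist_eq_zero := by
    rintro ⟨a⟩ ⟨b⟩ h
    exact Quotient.sound (s := wedgeSetoid x) (rel_of_sigmaDist_eq_zero x d h)

end Wedge

/-- The Hawaiian earring: the union of the circles in the plane with centre `(0, 1 / (n + 2))`
and radius `1 / (n + 2)`, for `n = 0, 1, 2, …`. -/
def hawaiianEarring : Set (EuclideanSpace ℝ (Fin 2)) :=
  ⋃ n : ℕ, Metric.sphere !₂[(0 : ℝ), 1 / ((n : ℝ) + 2)] (1 / ((n : ℝ) + 2))

end StrongAb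

end

/-! The retractions $r_n$ of the wedge $W$ induce a homomorphism $\pi_1(W)\to\prod_n h(X_n)$; it is
onto, and its kernel is the closed commutator subgroup $C$ of $W$. It is onto because loops $l_n$
can be run one after another in time intervals accumulating at 1; the spaces shrink, so the result
is continuous (`exists_loop`). The kernel contains $C$ because pointed maps act continuously on loop
spaces.

The other inclusion rests on `IsSplitting.mem_closedCommutator`: if at each time one of $a$, $b$
follows $l$ while the other rests, then $[l]=[a][b]$ modulo $C$. There may be infinitely many
alternations, so all that happens between visits to the base point at most $\delta$ apart is first
crushed to that point. Finitely many alternations matter after that, and the identity holds in the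
abelianization; closedness of $C$ allows $\delta\to0$. If every $r_n\circ l$ has class in the closed
commutator subgroup of $X_n$, then peeling off the first $N$ spaces does not change $[l]$ modulo
$C$. What remains tends to the constant loop, so closedness gives $[l]\in C$
(`loopClass_mem_closedCommutator`).

The argument only uses the axioms of `IsShrinkingWedge`, so it covers the earring directly; there
$h$ of the circle is $\mathbb Z$, since the trivial subgroup is already closed. -/

noncomputable section

namespace StrongAb

/-! ### Loop classes and cutting a loop at a visit to the base point -/

section LoopClasses

variable {X : Type u} [TopologicalSpace X] {o : X}

/-- The class of a loop in the fundamental group. -/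
def loopClass (l : Path o o) : FundamentalGroup X o :=
  FundamentalGroup.fromPath (Path.Homotopic.Quotient.mk l)

theorem loopClass_surjective : Function.Surjective (loopClass : Path o o → FundamentalGroup X o) :=
  Path.Homotopic.Quotient.mk_surjective

theorem mem_loopsOf {G : Subgroup (FundamentalGroup X o)} {l : Path o o} :
    l ∈ loopsOf G ↔ loopClass l ∈ G := Iff.rfl

/-- Multiplication in `FundamentalGroup` reverses the order of concatenation; hence the final piece
stands on the left below. -/
theorem loopClass_trans (p q : Path o o) :
    loopClass (p.trans q) = loopClass q * loopClass p := rfl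

theorem loopClass_symm (p : Path o o) : loopClass p.symm = (loopClass p)⁻¹ := rfl

theorem loopClass_refl : loopClass (Path.refl o) = 1 := rfl

theorem loopClass_eq {p q : Path o o} (h : p.Homotopic q) : loopClass p = loopClass q :=
  Path.Homotopic.Quotient.eq.2 h

theorem loopClass_reparam (p : Path o o) {f : unitInterval → unitInterval} (hf : Continuous f)
    (h0 : f 0 = 0) (h1 : f 1 = 1) : loopClass (p.reparam f hf h0 h1) = loopClass p :=
  (loopClass_eq ⟨Path.Homotopy.reparam p f hf h0 h1⟩).symm

/-- The loop `l` stopped at a time `t` at which it visits the base point. -/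
@[simps]
def initialLoop (l : Path o o) (t : unitInterval) (h : l t = o) : Path o o where
  toFun s := l (min s t)
  continuous_toFun := by fun_prop
  source' := by rw [min_eq_left unitInterval.nonneg', l.source]
  target' := by rw [min_eq_right unitInterval.le_one', h]

/-- The loop `l` started at a time `t` at which it visits the base point. -/
@[simps]
def finalLoop (l : Path o o) (t : unitInterval) (h : l t = o) : Path o o where
  toFun s := l (max s t)
  continuous_toFun := by fun_prop
  source' := by rw [max_eq_right unitInterval.nonneg', h]
  target' := by rw [max_eq_left unitInterval.le_one', l.target]

theorem loopClass_eq_final_mul_initial (l : Path o o) (t : unitInterval) (h : l t = o) :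
    loopClass l = loopClass (finalLoop l t h) * loopClass (initialLoop l t h) := by
  -- These are paths in the time interval: reparametrizing `l` by `p.trans q` gives exactly the
  -- concatenation of the two pieces.
  let p : Path (0 : unitInterval) t :=
    { toFun := fun s => min s t
      continuous_toFun := by fun_prop
      source' := min_eq_left unitInterval.nonneg'
      target' := by rw [min_eq_right unitInterval.le_one'] }
  let q : Path t (1 : unitInterval) :=
    { toFun := fun s => max s t
      continuous_toFun := by fun_prop
      source' := by rw [max_eq_right unitInterval.nonneg']
      target' := max_eq_left unitInterval.le_one' }
  rw [← loopClass_trans,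
    ← loopClass_reparam l (f := p.trans q) (p.trans q).continuous (p.trans q).source
      (p.trans q).target]
  congr 1
  ext s
  simp only [Path.coe_reparam, Function.comp_apply, Path.trans_apply]
  split_ifs <;> rfl

theorem initialLoop_one (l : Path o o) : initialLoop l 1 l.target = l := by
  ext s
  simp [min_eq_left unitInterval.le_one']

end LoopClasses

/-! ### Splittings with finitely many relevant alternations -/

section Splitting

variable {X : Type u} [TopologicalSpace X] {o : X} {l a b : Path o o}

/-- At each time one of the loops `a`, `b` agrees with `l` while the other one rests at the base
point. -/
def IsSplitting (l a b : Path o o) : Prop :=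
  ∀ t, (a t = l t ∧ b t = o) ∨ (b t = l t ∧ a t = o)

theorem IsSplitting.symm (h : IsSplitting l a b) : IsSplitting l b a := fun t => (h t).symm

theorem IsSplitting.left_eq (h : IsSplitting l a b) {t : unitInterval} (ht : l t = o) :
    a t = o := by
  rcases h t with h | h
  · exact h.1.trans ht
  · exact h.2

theorem IsSplitting.right_eq (h : IsSplitting l a b) {t : unitInterval} (ht : l t = o) :
    b t = o := h.symm.left_eq ht

theorem loopClass_initialLoop_of_le {s t : unitInterval} (hst : s ≤ t) (hs : l s = o)
    (ht : l t = o) :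
    loopClass (initialLoop l t ht) =
      loopClass (finalLoop (initialLoop l t ht) s (by simp [hst, hs])) *
        loopClass (initialLoop l s hs) := by
  rw [loopClass_eq_final_mul_initial (initialLoop l t ht) s (by simp [hst, hs])]
  congr 2
  ext u
  simp [hst]

theorem finalLoop_initialLoop_congr {s t : unitInterval} (hst : s ≤ t)
    {ht : l t = o} {ht' : a t = o} {hs hs'} (h : ∀ u ∈ Set.Icc s t, l u = a u) :
    finalLoop (initialLoop l t ht) s hs = finalLoop (initialLoop a t ht') s hs' := by
  ext u
  exact h _ ⟨le_min (le_max_right _ _) hst, min_le_right _ _⟩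

variable {A : Type*} [CommGroup A] (φ : FundamentalGroup X o →* A)

/-- Going from `s` to `t` multiplies the classes for `l` and `a` by the same factor and leaves that
of `b` alone. -/
theorem IsSplitting.map_initialLoop_of_pure (h : IsSplitting l a b) {s t : unitInterval}
    (hst : s ≤ t) (hs : l s = o) (ht : l t = o)
    (hpure : ∀ u ∈ Set.Icc s t, l u = a u ∧ b u = o)
    (ih : φ (loopClass (initialLoop l s hs)) =
      φ (loopClass (initialLoop a s (h.left_eq hs))) *
        φ (loopClass (initialLoop b s (h.right_eq hs)))) :
    φ (loopClass (initialLoop l t ht)) =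
      φ (loopClass (initialLoop a t (h.left_eq ht))) *
        φ (loopClass (initialLoop b t (h.right_eq ht))) := by
  rw [loopClass_initialLoop_of_le hst hs, loopClass_initialLoop_of_le hst (h.left_eq hs),
    loopClass_initialLoop_of_le hst (h.right_eq hs), map_mul, map_mul, map_mul, ih,
    finalLoop_initialLoop_congr (a := a) (ht' := h.left_eq ht) hst fun u hu => (hpure u hu).1]
  · have hb : finalLoop (initialLoop b t (h.right_eq ht)) s (by simp [hst, h.right_eq hs]) =
        Path.refl o := by
      ext u
      exact (hpure _ ⟨le_min (le_max_right _ _) hst, min_le_right _ _⟩).2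
    rw [hb, loopClass_refl, map_one, one_mul, mul_assoc]

/-- The times when `a` runs and those when `b` runs are closed sets, disjoint where `l` is off the
base point. By connectedness only one of the loops runs on all of $(s,t)$. -/
theorem IsSplitting.map_initialLoop_of_ne [T2Space X] (h : IsSplitting l a b)
    {s t : unitInterval} (hst : s ≤ t) (hs : l s = o) (ht : l t = o)
    (hne : ∀ u ∈ Set.Ioo s t, l u ≠ o)
    (ih : φ (loopClass (initialLoop l s hs)) =
      φ (loopClass (initialLoop a s (h.left_eq hs))) *
        φ (loopClass (initialLoop b s (h.right_eq hs)))) :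
    φ (loopClass (initialLoop l t ht)) =
      φ (loopClass (initialLoop a t (h.left_eq ht))) *
        φ (loopClass (initialLoop b t (h.right_eq ht))) := by
  have hc : ∀ p q : Path o o, IsClosed {u | p u = l u ∧ q u = o} := fun p q =>
    (isClosed_eq p.continuous l.continuous).inter (isClosed_eq q.continuous continuous_const)
  have hends : ∀ u ∈ Set.Icc s t, u ∉ Set.Ioo s t → l u = o := by
    intro u hu hu'
    rcases hu.1.eq_or_lt with rfl | h1
    · exact hs
    rcases hu.2.eq_or_lt with rfl | h2
    · exact ht
    exact absurd ⟨h1, h2⟩ hu'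
  rcases isPreconnected_iff_subset_of_disjoint_closed.1 (isPreconnected_Ioo (a := s) (b := t))
      _ _ (hc a b) (hc b a) (fun u _ => h u) (by
        refine Set.eq_empty_of_forall_notMem fun u hu => hne u hu.1 ?_
        exact hu.2.2.1.symm.trans hu.2.1.2) with hp | hp
  · refine h.map_initialLoop_of_pure φ hst hs ht (fun u hu => ?_) ih
    by_cases hu' : u ∈ Set.Ioo s t
    · exact ⟨(hp hu').1.symm, (hp hu').2⟩
    · have := hends u hu hu'
      exact ⟨this.trans (h.left_eq this).symm, h.right_eq this⟩
  · rw [mul_comm] at ih ⊢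
    refine h.symm.map_initialLoop_of_pure φ hst hs ht (fun u hu => ?_) ih
    by_cases hu' : u ∈ Set.Ioo s t
    · exact ⟨(hp hu').1.symm, (hp hu').2⟩
    · have := hends u hu hu'
      exact ⟨this.trans (h.right_eq this).symm, h.left_eq this⟩

/-- Visits of the loop `l` to its base point at times at distance at most `δ` belong to the same
stay at the base point. -/
def HasGap (l : Path o o) (δ : ℝ) : Prop :=
  ∀ s t u : unitInterval, l s = o → l t = o → s ≤ u → u ≤ t → (t : ℝ) - s ≤ δ → l u = o

/-- The formula is propagated from visit to visit, advancing by at least `δ`, so that 1 is reached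
after finitely many steps. -/
theorem IsSplitting.map_loopClass_of_hasGap [T2Space X] (h : IsSplitting l a b) {δ : ℝ}
    (hδ : 0 < δ) (hgap : HasGap l δ) :
    φ (loopClass l) = φ (loopClass a) * φ (loopClass b) := by
  let P : unitInterval → Prop := fun t => ∃ ht : l t = o,
    φ (loopClass (initialLoop l t ht)) =
      φ (loopClass (initialLoop a t (h.left_eq ht))) *
        φ (loopClass (initialLoop b t (h.right_eq ht)))
  have hrest : ∀ s t, P s → s ≤ t → l t = o → (t : ℝ) - s ≤ δ → P t := by
    rintro s t ⟨hs, ih⟩ hst ht hd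
    refine ⟨ht, h.map_initialLoop_of_pure φ hst hs ht (fun u hu => ?_) ih⟩
    have := hgap s t u hs ht hu.1 hu.2 hd
    exact ⟨this.trans (h.left_eq this).symm, h.right_eq this⟩
  have hzero : IsClosed {t | l t = o} := isClosed_eq l.continuous continuous_const
  have hstep : ∀ t, P t → P 1 ∨ ∃ t', P t' ∧ (t : ℝ) + δ ≤ t' := by
    intro t hPt
    by_cases hc : (t : ℝ) + δ < 1
    · right
      let c : unitInterval := ⟨t + δ, add_nonneg t.2.1 hδ.le, hc.le⟩
      have htc : t ≤ c := Subtype.coe_le_coe.1 (by simp only [c]; linarith)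
      -- The last visit `s'` up to $t+\delta$ is reached at rest, by the gap condition; the first
      -- visit `s''` from $t+\delta$ on is then reached by a single excursion.
      obtain ⟨s', ⟨hs'z, hs'1, hs'2⟩, hs'⟩ := (hzero.inter (isClosed_Icc (a := t) (b := c))
        ).isCompact.exists_isGreatest ⟨t, hPt.1, le_rfl, htc⟩
      obtain ⟨s'', ⟨hs''z, hs''1, hs''2⟩, hs''⟩ := (hzero.inter (isClosed_Icc (a := c) (b := 1))
        ).isCompact.exists_isLeast ⟨1, l.target, unitInterval.le_one', le_rfl⟩
      have hPs' : P s' := by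
        refine hrest t s' hPt hs'1 hs'z ?_
        have : (s' : ℝ) ≤ t + δ := hs'2
        linarith
      refine ⟨s'', ⟨hs''z, h.map_initialLoop_of_ne φ (hs'2.trans hs''1) hPs'.1 hs''z ?_ hPs'.2⟩,
        hs''1⟩
      rintro u ⟨hu1, hu2⟩ hu
      rcases le_total u c with huc | huc
      · exact hu1.not_ge (hs' ⟨hu, hs'1.trans hu1.le, huc⟩)
      · exact hu2.not_ge (hs'' ⟨hu, huc, unitInterval.le_one'⟩)
    · left
      refine hrest t 1 hPt unitInterval.le_one' l.target ?_
      rw [Set.Icc.coe_one]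
      linarith
  have hP0 : P 0 := by
    have h0 : ∀ (p : Path o o), initialLoop p 0 p.source = Path.refl o := by
      intro p
      ext u
      simp
    exact ⟨l.source, by rw [h0, h0, h0, loopClass_refl, map_one, one_mul]⟩
  have hP1 : P 1 := by
    by_contra hP1
    have hall : ∀ k : ℕ, ∃ t, P t ∧ k * δ ≤ (t : ℝ) := by
      intro k
      induction k with
      | zero => exact ⟨0, hP0, by simp⟩
      | succ k ih =>
        obtain ⟨t, hPt, ht⟩ := ih
        obtain ⟨t', hPt', ht'⟩ := (hstep t hPt).resolve_left hP1
        refine ⟨t', hPt', ?_⟩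
        push_cast
        linarith
    obtain ⟨k, hk⟩ := exists_nat_gt (1 / δ)
    obtain ⟨t, -, ht⟩ := hall k
    rw [div_lt_iff₀ hδ] at hk
    linarith [t.2.2]
  obtain ⟨h1, h2⟩ := hP1
  rwa [initialLoop_one, initialLoop_one, initialLoop_one] at h2

end Splitting

/-! ### Crushing short excursions -/

section Crush

variable {X : Type u} [TopologicalSpace X] {o : X}

/-- The times between two visits of the loop `l` to its base point at distance at most `δ`. -/
def crushSet (l : Path o o) (δ : ℝ) : Set unitInterval :=
  {u | ∃ s t : unitInterval, l s = o ∧ l t = o ∧ s ≤ u ∧ u ≤ t ∧ (t : ℝ) - s ≤ δ}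

theorem isClosed_crushSet [T1Space X] (l : Path o o) (δ : ℝ) : IsClosed (crushSet l δ) := by
  have hz : IsClosed {t | l t = o} := isClosed_singleton.preimage l.continuous
  have h : IsClosed {p : unitInterval × unitInterval × unitInterval |
      l p.1 = o ∧ l p.2.1 = o ∧ p.1 ≤ p.2.2 ∧ p.2.2 ≤ p.2.1 ∧ (p.2.1 : ℝ) - p.1 ≤ δ} :=
    (hz.preimage continuous_fst).inter <| (hz.preimage continuous_snd.fst).inter <|
      (isClosed_le continuous_fst continuous_snd.snd).inter <|
        (isClosed_le continuous_snd.snd continuous_snd.fst).inter <|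
          isClosed_le (Continuous.sub (continuous_subtype_val.comp continuous_snd.fst)
            (continuous_subtype_val.comp continuous_fst)) continuous_const
  convert (h.isCompact.image (f := fun p => p.2.2) (by fun_prop)).isClosed using 1
  ext u
  simp only [crushSet, Set.mem_image, Set.mem_ofPred_eq, Prod.exists]
  constructor
  · rintro ⟨s, t, h⟩
    exact ⟨s, t, u, h, rfl⟩
  · rintro ⟨s, t, u, h, rfl⟩
    exact ⟨s, t, h⟩

/-- A time strictly between its two witnesses is interior, so a frontier time is itself a visit.
This is what makes `crush` continuous. -/
theorem eq_of_mem_frontier_crushSet [T1Space X] {l : Path o o} {δ : ℝ} {u : unitInterval}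
    (hu : u ∈ frontier (crushSet l δ)) : l u = o := by
  obtain ⟨s, t, hs, ht, hsu, hut, hd⟩ := (isClosed_crushSet l δ).frontier_subset hu
  rcases hsu.eq_or_lt with rfl | hsu
  · exact hs
  rcases hut.eq_or_lt with rfl | hut
  · exact ht
  refine absurd ?_ hu.2
  refine mem_interior.2 ⟨Set.Ioo s t, fun v hv => ?_, isOpen_Ioo, hsu, hut⟩
  exact ⟨s, t, hs, ht, hv.1.le, hv.2.le, hd⟩

open Classical in
/-- The loop `p`, kept at the base point during `crushSet l δ`. -/
def crush [T1Space X] (l p : Path o o) (h : ∀ u, l u = o → p u = o) (δ : ℝ) : Path o o where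
  toFun := (crushSet l δ).piecewise (fun _ => o) p
  continuous_toFun := Continuous.piecewise
    (fun _ hu => (h _ (eq_of_mem_frontier_crushSet hu)).symm) continuous_const p.continuous
  source' := by simp [Set.piecewise]
  target' := by simp [Set.piecewise]

variable [T1Space X] {l p : Path o o} {h : ∀ u, l u = o → p u = o} {δ : ℝ} {u : unitInterval}

theorem crush_of_mem (hu : u ∈ crushSet l δ) : crush l p h δ u = o := by
  
  simp [crush, hu]

theorem crush_of_notMem (hu : u ∉ crushSet l δ) : crush l p h δ u = p u := by
  
  simp [crush, hu]

/-- If `u` were not crushed, each visit of the crushed loop around `u` could be moved towards `u` to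
a visit of `l`; the two would be at most `δ` apart and force `u` to be crushed. -/
theorem hasGap_crush : HasGap (crush l l (fun _ => id) δ) δ := by
  intro s t u hs ht hsu hut hd
  by_contra hu
  have huC : u ∉ crushSet l δ := fun h => hu (crush_of_mem h)
  have h1 : ∃ s' : unitInterval, l s' = o ∧ s ≤ s' ∧ s' ≤ u := by
    by_cases hsC : s ∈ crushSet l δ
    · obtain ⟨s1, s2, h1, h2, h3, h4, h5⟩ := hsC
      refine ⟨s2, h2, h4, le_of_not_ge fun h => huC ⟨s1, s2, h1, h2, h3.trans hsu, h, h5⟩⟩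
    · exact ⟨s, (crush_of_notMem hsC).symm.trans hs, le_rfl, hsu⟩
  have h2 : ∃ t' : unitInterval, l t' = o ∧ u ≤ t' ∧ t' ≤ t := by
    by_cases htC : t ∈ crushSet l δ
    · obtain ⟨t1, t2, h1, h2, h3, h4, h5⟩ := htC
      refine ⟨t1, h1, le_of_not_ge fun h => huC ⟨t1, t2, h1, h2, h, hut.trans h4, h5⟩, h3⟩
    · exact ⟨t, (crush_of_notMem htC).symm.trans ht, hut, le_rfl⟩
  obtain ⟨s', hs', hss', hs'u⟩ := h1
  obtain ⟨t', ht', hut', ht't⟩ := h2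
  refine huC ⟨s', t', hs', ht', hs'u, hut', ?_⟩
  have h3 : (s : ℝ) ≤ s' := hss'
  have h4 : (t' : ℝ) ≤ t := ht't
  linarith

theorem IsSplitting.isSplitting_crush {l a b : Path o o} (h : IsSplitting l a b) (δ : ℝ) :
    IsSplitting (crush l l (fun _ => id) δ) (crush l a (fun _ => h.left_eq) δ)
      (crush l b (fun _ => h.right_eq) δ) := by
  intro t
  by_cases ht : t ∈ crushSet l δ
  · exact Or.inl ⟨by rw [crush_of_mem ht, crush_of_mem ht], crush_of_mem ht⟩
  · simp only [crush_of_notMem ht]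
    exact h t

end Crush

/-! ### Passage to the limit in the loop space -/

section Limit

variable {X : Type u} [MetricSpace X] {o : X}

theorem tendsto_path_iff {ι : Type*} {F : Filter ι} {p : ι → Path o o} {q : Path o o} :
    Filter.Tendsto p F (𝓝 q) ↔ ∀ ε > 0, ∀ᶠ i in F, ∀ t, dist (q t) (p i t) < ε := by
  have h : IsInducing (fun r : Path o o => r.toContinuousMap) := ⟨rfl⟩
  rw [h.tendsto_nhds_iff, ContinuousMap.tendsto_iff_tendstoUniformly,
    Metric.tendstoUniformly_iff]
  rfl

/-- A crushed time is within `δ` of a visit of `l`, where `p` is also at the base point; uniform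
continuity of `p` bounds the change. -/
theorem tendsto_crush (l p : Path o o) (h : ∀ u, l u = o → p u = o) :
    Filter.Tendsto (fun δ => crush l p h δ) (𝓝[>] (0 : ℝ)) (𝓝 p) := by
  rw [tendsto_path_iff]
  intro ε hε
  have huc : UniformContinuous p :=
    CompactSpace.uniformContinuous_of_continuous p.continuous
  obtain ⟨η, hη, hp⟩ := Metric.uniformContinuous_iff.1 huc ε hε
  filter_upwards [Ioo_mem_nhdsGT hη] with δ hδ t
  by_cases ht : t ∈ crushSet l δ
  · rw [crush_of_mem ht]
    obtain ⟨s, s', hs, -, hst, hts', hd⟩ := ht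
    refine (congrArg (dist (p t)) (h s hs)).symm.trans_lt (hp ?_)
    have h1 : (s : ℝ) ≤ t := hst
    have h2 : (t : ℝ) ≤ s' := hts'
    rw [Subtype.dist_eq, Real.dist_eq, abs_lt]
    constructor <;> linarith [hδ.1, hδ.2]
  · rw [crush_of_notMem ht, dist_self]
    exact hε

theorem tendsto_trans {ι : Type*} {F : Filter ι} {p q : ι → Path o o} {p' q' : Path o o}
    (hp : Filter.Tendsto p F (𝓝 p')) (hq : Filter.Tendsto q F (𝓝 q')) :
    Filter.Tendsto (fun i => (p i).trans (q i)) F (𝓝 (p'.trans q')) :=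
  (Path.continuous_trans.tendsto (p', q')).comp (hp.prodMk_nhds hq)

theorem tendsto_symm {ι : Type*} {F : Filter ι} {p : ι → Path o o} {p' : Path o o}
    (hp : Filter.Tendsto p F (𝓝 p')) : Filter.Tendsto (fun i => (p i).symm) F (𝓝 p'.symm) :=
  (Path.continuous_symm.tendsto p').comp hp

theorem IsClosedSubgroup.mem_of_tendsto {G : Subgroup (FundamentalGroup X o)}
    (hG : IsClosedSubgroup G) {ι : Type*} {F : Filter ι} [F.NeBot] {p : ι → Path o o}
    {q : Path o o} (hp : Filter.Tendsto p F (𝓝 q)) (h : ∀ᶠ i in F, loopClass (p i) ∈ G) :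
    loopClass q ∈ G :=
  IsClosed.mem_of_tendsto (s := loopsOf G) hG hp h

theorem isClosedSubgroup_closedCommutator : IsClosedSubgroup (closedCommutator X o) :=
  isClosedSubgroup_closedHull _

theorem commutator_le_closedCommutator :
    commutator (FundamentalGroup X o) ≤ closedCommutator X o :=
  le_closedHull _

theorem IsSplitting.mem_closedCommutator {l a b : Path o o} (h : IsSplitting l a b) :
    loopClass l * (loopClass a)⁻¹ * (loopClass b)⁻¹ ∈ closedCommutator X o := by
  have hlim : Filter.Tendsto (fun δ => (crush l b (fun _ => h.right_eq) δ).symm.trans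
      ((crush l a (fun _ => h.left_eq) δ).symm.trans (crush l l (fun _ => id) δ)))
      (𝓝[>] (0 : ℝ)) (𝓝 (b.symm.trans (a.symm.trans l))) := by
    exact tendsto_trans (tendsto_symm (tendsto_crush _ _ _))
      (tendsto_trans (tendsto_symm (tendsto_crush _ _ _)) (tendsto_crush _ _ _))
  -- For each `δ > 0` the crushed word already lies in the ordinary commutator subgroup.
  refine isClosedSubgroup_closedCommutator.mem_of_tendsto hlim ?_
  filter_upwards [self_mem_nhdsWithin] with δ hδ
  refine commutator_le_closedCommutator ?_
  have := (h.isSplitting_crush δ).map_loopClass_of_hasGap Abelianization.of hδ hasGap_crush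
  simp only [loopClass_trans, loopClass_symm]
  rw [← Abelianization.ker_of, MonoidHom.mem_ker]
  simp only [map_mul, map_inv]
  rw [this]
  simp [mul_assoc]

end Limit

/-! ### Functoriality and change of base point -/

section Functoriality

universe v

variable {X : Type u} [TopologicalSpace X] {Y : Type v} [TopologicalSpace Y] {x : X} {y : Y}

/-- As `φ` comes from a continuous map of loop spaces, preimages of closed subgroups are closed, and
the hull is minimal. -/
theorem closedCommutator_le_comap (φ : FundamentalGroup X x →* FundamentalGroup Y y)
    {Φ : Path x x → Path y y} (hΦ : Continuous Φ)
    (h : ∀ l, φ (loopClass l) = loopClass (Φ l)) :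
    closedCommutator X x ≤ (closedCommutator Y y).comap φ := by
  refine closedHull_le ?_ ?_
  · rw [← Subgroup.map_le_iff_le_comap, commutator_def, Subgroup.map_commutator]
    exact (Subgroup.commutator_mono le_top le_top).trans (le_closedHull _)
  · have : loopsOf ((closedCommutator Y y).comap φ) = Φ ⁻¹' loopsOf (closedCommutator Y y) := by
      ext l
      rw [Set.mem_preimage, mem_loopsOf, mem_loopsOf, Subgroup.mem_comap, h]
    unfold IsClosedSubgroup
    rw [this]
    exact (isClosedSubgroup_closedHull _).preimage hΦ

theorem map_closedCommutator (e : FundamentalGroup X x ≃* FundamentalGroup Y y)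
    {Φ : Path x x → Path y y} (hΦ : Continuous Φ)
    (h : ∀ l, e (loopClass l) = loopClass (Φ l))
    {Ψ : Path y y → Path x x} (hΨ : Continuous Ψ)
    (h' : ∀ l, e.symm (loopClass l) = loopClass (Ψ l)) :
    (closedCommutator X x).map (e : FundamentalGroup X x →* FundamentalGroup Y y) =
      closedCommutator Y y := by
  refine le_antisymm ?_ ?_
  · rw [Subgroup.map_le_iff_le_comap]
    exact closedCommutator_le_comap (e : FundamentalGroup X x →* FundamentalGroup Y y) hΦ h
  · intro g hg
    exact ⟨e.symm g, closedCommutator_le_comap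
      (e.symm : FundamentalGroup Y y →* FundamentalGroup X x) hΨ h' hg, e.apply_symm_apply g⟩

/-- The image of a loop under a pointed map. -/
def mapLoop (f : C(X, Y)) (h : f x = y) (l : Path x x) : Path y y :=
  (l.map f.continuous).cast h.symm h.symm

@[simp]
theorem mapLoop_apply (f : C(X, Y)) (h : f x = y) (l : Path x x) (t : unitInterval) :
    mapLoop f h l t = f (l t) := rfl

theorem continuous_mapLoop (f : C(X, Y)) (h : f x = y) : Continuous (mapLoop f h) := by
  have hi : IsInducing (fun r : Path y y => r.toContinuousMap) := ⟨rfl⟩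
  exact hi.continuous_iff.2 (f.continuous_postcomp.comp continuous_induced_dom)

theorem mapOfEq_loopClass (f : C(X, Y)) (h : f x = y) (l : Path x x) :
    FundamentalGroup.mapOfEq f h (loopClass l) = loopClass (mapLoop f h l) := by
  rw [FundamentalGroup.mapOfEq_apply]
  rfl

theorem closedCommutator_le_comap_mapOfEq (f : C(X, Y)) (h : f x = y) :
    closedCommutator X x ≤ (closedCommutator Y y).comap (FundamentalGroup.mapOfEq f h) :=
  closedCommutator_le_comap _ (continuous_mapLoop f h) (mapOfEq_loopClass f h)

theorem loopClass_mapLoop_mem (f : C(X, Y)) (h : f x = y) {l : Path x x}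
    (hl : loopClass l ∈ closedCommutator X x) :
    loopClass (mapLoop f h l) ∈ closedCommutator Y y := by
  rw [← mapOfEq_loopClass]
  exact closedCommutator_le_comap_mapOfEq f h hl

theorem continuous_conjLoop {x' : X} (p : Path x' x) (q : Path x x') :
    Continuous fun l : Path x x => p.trans (l.trans q) :=
  Path.continuous_trans.comp (continuous_const.prodMk
    (Path.continuous_trans.comp (continuous_id.prodMk continuous_const)))

theorem nonempty_strongAbelianization_mulEquiv_of_path {x' : X} (p : Path x x') :
    Nonempty (StrongAbelianization X x ≃* StrongAbelianization X x') :=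
  ⟨QuotientGroup.congr _ _ (FundamentalGroup.fundamentalGroupMulEquivOfPath p)
    (map_closedCommutator _ (continuous_conjLoop p.symm p) (fun _ => rfl)
      (continuous_conjLoop p p.symm) (fun _ => rfl))⟩

end Functoriality

/-! ### Pasting infinitely many loops -/

section Pasting

theorem continuous_ite_of_isClosed {T W : Type*} [TopologicalSpace T] [TopologicalSpace W]
    {f g : T → W} (hf : Continuous f) (hg : Continuous g) {S S' : Set T}
    [DecidablePred (· ∈ S)] (hS : IsClosed S) (hS' : IsClosed S') (hcover : ∀ t, t ∈ S ∨ t ∈ S')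
    (hfg : ∀ t, t ∈ S → t ∈ S' → f t = g t) :
    Continuous fun t => if t ∈ S then f t else g t := by
  refine Continuous.if (fun t ht => hfg t (hS.frontier_subset ht) ?_) hf hg
  have h : closure Sᶜ ⊆ S' := hS'.closure_subset_iff.2 fun t ht => (hcover t).resolve_left ht
  rw [frontier_eq_closure_inter_closure] at ht
  exact h ht.2

variable {W : Type u} [MetricSpace W] {o : W}

/-- Finitely many of the loops are pasted along closed sets; `L` is the uniform limit of these
combinations. -/
theorem exists_path_of_disjoint (f : ℕ → Path o o)
    (hdisj : ∀ m n, m ≠ n → ∀ t, f m t = o ∨ f n t = o)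
    (hf : ∀ ε > 0, ∃ N, ∀ n ≥ N, ∀ t, dist o (f n t) < ε) :
    ∃ L : Path o o, ∀ t, (∀ n, f n t ≠ o → L t = f n t) ∧ ((∀ n, f n t = o) → L t = o) := by
  classical
  have hpartial : ∀ N : ℕ, ∃ F : unitInterval → W, Continuous F ∧
      ∀ t, (∀ n < N, f n t ≠ o → F t = f n t) ∧ ((∀ n < N, f n t = o) → F t = o) := by
    intro N
    induction N with
    | zero => exact ⟨fun _ => o, continuous_const, fun t => ⟨by simp, fun _ => rfl⟩⟩
    | succ N ih =>
      obtain ⟨F, hF, h⟩ := ih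
      refine ⟨fun t => if t ∈ {t | f N t = o} then F t else f N t,
        continuous_ite_of_isClosed hF (f N).continuous (S' := {t | F t = o})
          (isClosed_eq (f N).continuous continuous_const) (isClosed_eq hF continuous_const)
          (fun t => ?_) (fun t h1 h2 => Eq.trans h2 (Eq.symm h1)), fun t => ⟨?_, ?_⟩⟩
      · by_cases ht : f N t = o
        · exact Or.inl ht
        · exact Or.inr ((h t).2 fun n hn => (hdisj n N hn.ne t).resolve_right ht)
      · intro n hn hnt
        rcases Nat.lt_succ_iff_lt_or_eq.1 hn with hn | rfl
        · simp [(hdisj n N hn.ne t).resolve_left hnt, (h t).1 n hn hnt]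
        · simp [hnt]
      · intro ht
        simp [ht N N.lt_succ_self, (h t).2 fun n hn => ht n (hn.trans N.lt_succ_self)]
  choose F hF hFf using hpartial
  have hL : ∀ t, ∃ w, (∀ n, f n t ≠ o → w = f n t) ∧ ((∀ n, f n t = o) → w = o) := by
    intro t
    by_cases h : ∃ n, f n t ≠ o
    · obtain ⟨n, hn⟩ := h
      refine ⟨f n t, fun m hm => ?_, fun h => absurd (h n) hn⟩
      by_cases hmn : m = n
      · rw [hmn]
      · exact absurd (hdisj m n hmn t) (by simp [hm, hn])
    · push Not at h
      exact ⟨o, fun n hn => absurd (h n) hn, fun _ => rfl⟩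
  choose L hL using hL
  have hlim : TendstoUniformly F L Filter.atTop := by
    rw [Metric.tendstoUniformly_iff]
    intro ε hε
    obtain ⟨N, hN⟩ := hf ε hε
    filter_upwards [Filter.eventually_ge_atTop N] with M hM t
    by_cases h : ∃ n, f n t ≠ o
    · obtain ⟨n, hn⟩ := h
      rw [(hL t).1 n hn]
      rcases lt_or_ge n M with hnM | hnM
      · rw [(hFf M t).1 n hnM hn, dist_self]
        exact hε
      · rw [(hFf M t).2 fun m hm => (hdisj m n (hm.trans_le hnM).ne t).resolve_right hn,
          dist_comm]
        exact hN n (hM.trans hnM) t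
    · push Not at h
      rw [(hL t).2 h, (hFf M t).2 fun n _ => h n, dist_self]
      exact hε
  refine ⟨⟨⟨L, hlim.continuous (Filter.Frequently.of_forall hF)⟩, ?_, ?_⟩, hL⟩
  · exact (hL 0).2 fun n => (f n).source
  · exact (hL 1).2 fun n => (f n).target

theorem exists_disjoint_reparametrizations :
    ∃ φ : ℕ → C(unitInterval, unitInterval), (∀ n, φ n 0 = 0) ∧ (∀ n, φ n 1 = 1) ∧
      ∀ m n, m < n → ∀ t, φ m t = 1 ∨ φ n t = 0 := by
  -- The clamped affine map rises from 0 to 1 exactly on $[1-2^{-n},1-2^{-(n+1)}]$.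
  refine ⟨fun n => ⟨fun t => Set.projIcc 0 1 zero_le_one (2 ^ (n + 1) * ((t : ℝ) - 1) + 2),
    by fun_prop⟩, fun n => ?_, fun n => ?_, fun m n hmn t => ?_⟩
  · refine Set.projIcc_of_le_left zero_le_one ?_
    have : (1 : ℝ) ≤ 2 ^ n := one_le_pow₀ one_le_two
    rw [Set.Icc.coe_zero, pow_succ]
    linarith
  · refine Set.projIcc_of_right_le zero_le_one ?_
    norm_num
  · by_cases h : 1 ≤ (2 : ℝ) ^ (m + 1) * ((t : ℝ) - 1) + 2
    · exact Or.inl (Set.projIcc_of_right_le zero_le_one h)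
    · refine Or.inr (Set.projIcc_of_le_left zero_le_one ?_)
      have h1 : (2 : ℝ) ^ (m + 1) * 2 ≤ 2 ^ (n + 1) := by
        rw [← pow_succ]
        exact pow_le_pow_right₀ one_le_two (by omega)
      have h2 : (t : ℝ) - 1 ≤ 0 := by linarith [t.2.2]
      have := mul_le_mul_of_nonpos_right h1 h2
      push Not at h
      linarith

end Pasting

/-! ### The isomorphism for abstract shrinking wedges -/

section Wedges

universe v

variable {W : Type u} [MetricSpace W]

/-- The metric space `W` is a shrinking wedge at `o` of the pointed spaces `(X n, x n)`, with
inclusions `i n` and retractions `r n`. -/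
structure IsShrinkingWedge (o : W) {X : ℕ → Type v} [∀ n, TopologicalSpace (X n)]
    (x : ∀ n, X n) (i : ∀ n, C(X n, W)) (r : ∀ n, C(W, X n)) : Prop where
  incl_base : ∀ n, i n (x n) = o
  retr_incl : ∀ n y, r n (i n y) = y
  retr_incl_of_ne : ∀ m n, m ≠ n → ∀ y, r m (i n y) = x m
  exists_incl_eq : ∀ w, ∃ n y, i n y = w
  dist_lt : ∀ ε > 0, ∃ N, ∀ n ≥ N, ∀ y, dist o (i n y) < ε

namespace IsShrinkingWedge

variable {o : W} {X : ℕ → Type v} [∀ n, TopologicalSpace (X n)] {x : ∀ n, X n}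
  {i : ∀ n, C(X n, W)} {r : ∀ n, C(W, X n)} (h : IsShrinkingWedge o x i r)
include h

theorem retr_base (n : ℕ) : r n o = x n := by
  rw [← h.incl_base n, h.retr_incl]

theorem incl_retr_incl_of_ne {m n : ℕ} (hmn : m ≠ n) (y : X n) : i m (r m (i n y)) = o := by
  rw [h.retr_incl_of_ne m n hmn, h.incl_base]

theorem exists_collapse (n : ℕ) : ∃ q : C(W, W), (∀ y, q (i n y) = o) ∧
    ∀ m, m ≠ n → ∀ y, q (i m y) = i m y := by
  classical
  have hc : Continuous fun w => i n (r n w) := (i n).continuous.comp (r n).continuous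
  refine ⟨⟨fun w => if w ∈ {w | i n (r n w) = o} then w else o,
    continuous_ite_of_isClosed (S' := {w | i n (r n w) = w}) continuous_id continuous_const
      (isClosed_eq hc continuous_const) (isClosed_eq hc continuous_id) (fun w => ?_)
      (fun w h1 h2 => Eq.trans (Eq.symm h2) h1)⟩, fun y => ?_, fun m hm y => ?_⟩
  · obtain ⟨m, y, rfl⟩ := h.exists_incl_eq w
    by_cases hm : n = m
    · subst hm
      exact Or.inr (congrArg (i n) (h.retr_incl n y))
    · exact Or.inl (h.incl_retr_incl_of_ne hm y)
  · simp [h.retr_incl]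
  · simp [h.incl_retr_incl_of_ne hm.symm]

theorem exists_collapse_initial (N : ℕ) : ∃ q : C(W, W), (∀ n < N, ∀ y, q (i n y) = o) ∧
    ∀ n, N ≤ n → ∀ y, q (i n y) = i n y := by
  induction N with
  | zero => exact ⟨ContinuousMap.id W, by simp, fun _ _ _ => rfl⟩
  | succ N ih =>
    obtain ⟨q, hq1, hq2⟩ := ih
    obtain ⟨q', hq1', hq2'⟩ := h.exists_collapse N
    refine ⟨q'.comp q, fun n hn y => ?_, fun n hn y => ?_⟩
    · rcases Nat.lt_succ_iff_lt_or_eq.1 hn with hn | rfl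
      · rw [ContinuousMap.comp_apply, hq1 n hn, ← h.incl_base N, hq1', h.incl_base]
      · rw [ContinuousMap.comp_apply, hq2 n le_rfl, hq1']
    · rw [ContinuousMap.comp_apply, hq2 n (by omega), hq2' n (by omega)]

theorem dist_collapse_initial_lt {ε : ℝ} (hε : 0 < ε) {N : ℕ}
    (hN : ∀ n ≥ N, ∀ y, dist o (i n y) < ε) {q : C(W, W)} (hq : ∀ n < N, ∀ y, q (i n y) = o)
    (hq' : ∀ n, N ≤ n → ∀ y, q (i n y) = i n y) (w : W) : dist o (q w) < ε := by
  obtain ⟨n, y, rfl⟩ := h.exists_incl_eq w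
  rcases lt_or_ge n N with hn | hn
  · rwa [hq n hn, dist_self]
  · rw [hq' n hn]
    exact hN n hn y

/-- Here `q N` collapses the first `N` spaces: by `hclass` this preserves the class of `l` modulo
the closed commutator subgroup, while the collapsed loops tend to the constant one. -/
theorem loopClass_mem_closedCommutator {l : Path o o}
    (hl : ∀ n, loopClass (mapLoop (r n) (h.retr_base n) l) ∈ closedCommutator (X n) (x n)) :
    loopClass l ∈ closedCommutator W o := by
  choose q hq hq' using h.exists_collapse_initial
  have hqo : ∀ N, q N o = o := by
    intro N
    rcases Nat.eq_zero_or_pos N with rfl | hN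
    · rw [← h.incl_base 0, hq' 0 0 le_rfl]
    · rw [← h.incl_base 0, hq N 0 hN, h.incl_base]
  have hclass : ∀ N, (loopClass (mapLoop (q N) (hqo N) l) : StrongAbelianization W o) =
      loopClass l := by
    intro N
    induction N with
    | zero =>
      congr 2
      ext t
      obtain ⟨n, y, hy⟩ := h.exists_incl_eq (l t)
      rw [mapLoop_apply, ← hy, hq' 0 n n.zero_le]
    | succ N ih =>
      -- The part of `l` in the `N`-th space is peeled off; its class is negligible by `hl N`.
      have hsplit : IsSplitting (mapLoop (q N) (hqo N) l)
          (mapLoop (i N) (h.incl_base N) (mapLoop (r N) (h.retr_base N) l))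
          (mapLoop (q (N + 1)) (hqo (N + 1)) l) := by
        intro t
        simp only [mapLoop_apply]
        obtain ⟨n, y, hy⟩ := h.exists_incl_eq (l t)
        rw [← hy]
        rcases lt_trichotomy n N with hn | rfl | hn
        · left
          rw [h.incl_retr_incl_of_ne hn.ne', hq N n hn, hq (N + 1) n (by omega)]
          exact ⟨rfl, rfl⟩
        · left
          rw [h.retr_incl, hq' n n le_rfl, hq (n + 1) n (by omega)]
          exact ⟨rfl, rfl⟩
        · right
          rw [h.incl_retr_incl_of_ne hn.ne, hq' N n hn.le, hq' (N + 1) n (by omega)]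
          exact ⟨rfl, rfl⟩
      rw [← ih, QuotientGroup.eq]
      have h1 := hsplit.mem_closedCommutator
      have h2 := loopClass_mapLoop_mem (i N) (h.incl_base N) (hl N)
      have h3 := (closedCommutator_normal W o).mem_comm h1
      rw [← mul_assoc] at h3
      exact (Subgroup.mul_mem_cancel_right _ (inv_mem h2)).1 h3
  have hlim : Filter.Tendsto (fun N => (mapLoop (q N) (hqo N) l).symm.trans l) Filter.atTop
      (𝓝 ((Path.refl o).symm.trans l)) := by
    refine tendsto_trans (tendsto_symm (tendsto_path_iff.2 fun ε hε => ?_)) tendsto_const_nhds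
    obtain ⟨N, hN⟩ := h.dist_lt ε hε
    filter_upwards [Filter.eventually_ge_atTop N] with M hM t
    exact h.dist_collapse_initial_lt hε (fun n hn => hN n (hM.trans hn)) (hq M) (hq' M) _
  have := isClosedSubgroup_closedCommutator.mem_of_tendsto hlim (Filter.Eventually.of_forall
    fun N => by
      rw [loopClass_trans, loopClass_symm]
      exact (closedCommutator_normal W o).mem_comm (QuotientGroup.eq.1 (hclass N)))
  rwa [loopClass_trans, loopClass_symm, loopClass_refl, inv_one, mul_one] at this

theorem exists_loop (l : ∀ n, Path (x n) (x n)) :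
    ∃ L : Path o o, ∀ n, loopClass (mapLoop (r n) (h.retr_base n) L) = loopClass (l n) := by
  obtain ⟨φ, hφ0, hφ1, hφ⟩ := exists_disjoint_reparametrizations
  let f : ∀ n, Path o o := fun n =>
    mapLoop (i n) (h.incl_base n) ((l n).reparam (φ n) (φ n).continuous (hφ0 n) (hφ1 n))
  have hf : ∀ n t, f n t = i n (l n (φ n t)) := fun _ _ => rfl
  have hzero : ∀ n t, φ n t = 0 → f n t = o := by
    intro n t ht
    rw [hf, ht, (l n).source, h.incl_base]
  have hone : ∀ n t, φ n t = 1 → f n t = o := by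
    intro n t ht
    rw [hf, ht, (l n).target, h.incl_base]
  obtain ⟨L, hL⟩ := exists_path_of_disjoint f (fun m n hmn t => by
      rcases hmn.lt_or_gt with hlt | hlt
      · exact (hφ m n hlt t).imp (hone m t) (hzero n t)
      · exact ((hφ n m hlt t).imp (hone n t) (hzero m t)).symm) (fun ε hε => by
      obtain ⟨N, hN⟩ := h.dist_lt ε hε
      exact ⟨N, fun n hn t => hN n hn _⟩)
  refine ⟨L, fun n => ?_⟩
  rw [← loopClass_reparam (l n) (φ n).continuous (hφ0 n) (hφ1 n)]
  congr 1
  ext t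
  rw [mapLoop_apply, Path.coe_reparam, Function.comp_apply]
  by_cases hn : f n t = o
  · have hx : l n (φ n t) = x n := by
      rw [← h.retr_incl n (l n (φ n t)), ← hf, hn, h.retr_base]
    rw [hx]
    by_cases hm : ∃ m, f m t ≠ o
    · obtain ⟨m, hm⟩ := hm
      rw [(hL t).1 m hm, hf, h.retr_incl_of_ne]
      rintro rfl
      exact hm hn
    · push Not at hm
      rw [(hL t).2 hm, h.retr_base]
  · rw [(hL t).1 n hn, hf, h.retr_incl]

theorem nonempty_mulEquiv_pi : Nonempty (StrongAbelianization W o ≃*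
    ∀ n, StrongAbelianization (X n) (x n)) := by
  let Φ : FundamentalGroup W o →* ∀ n, StrongAbelianization (X n) (x n) :=
    MonoidHom.pi fun n => (QuotientGroup.mk' (closedCommutator (X n) (x n))).comp
      (FundamentalGroup.mapOfEq (r n) (h.retr_base n))
  have hΦ : ∀ l n, Φ (loopClass l) n = loopClass (mapLoop (r n) (h.retr_base n) l) :=
    fun l n => congrArg _ (mapOfEq_loopClass (r n) (h.retr_base n) l)
  have hker : Φ.ker = closedCommutator W o := by
    ext g
    obtain ⟨l, rfl⟩ := loopClass_surjective g
    rw [MonoidHom.mem_ker, funext_iff]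
    simp only [hΦ, Pi.one_apply, QuotientGroup.eq_one_iff]
    exact ⟨h.loopClass_mem_closedCommutator, fun hl n =>
      loopClass_mapLoop_mem (r n) (h.retr_base n) hl⟩
  have hsurj : Function.Surjective Φ := by
    intro g
    choose g' hg' using fun n => QuotientGroup.mk_surjective (g n)
    choose l hl using fun n => loopClass_surjective (g' n)
    obtain ⟨L, hL⟩ := h.exists_loop l
    refine ⟨loopClass L, funext fun n => ?_⟩
    rw [hΦ, hL, hl, hg']
  exact ⟨(QuotientGroup.quotientMulEquivOfEq hker.symm).trans
    (QuotientGroup.quotientKerEquivOfSurjective Φ hsurj)⟩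

theorem joined (hX : ∀ n, PathConnectedSpace (X n)) (w : W) : Joined w o := by
  obtain ⟨n, y, rfl⟩ := h.exists_incl_eq w
  have := hX n
  rw [← h.incl_base n]
  exact ⟨(PathConnectedSpace.somePath y (x n)).map (i n).continuous⟩

/-- The strong abelianization of a shrinking wedge of path-connected spaces is the product of
their strong abelianizations, for all base points. -/
theorem nonempty_mulEquiv_pi_of_pathConnected (hX : ∀ n, PathConnectedSpace (X n)) (w : W)
    (y : ∀ n, X n) : Nonempty (StrongAbelianization W w ≃*
      ∀ n, StrongAbelianization (X n) (y n)) := by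
  obtain ⟨p⟩ := h.joined hX w
  obtain ⟨e⟩ := nonempty_strongAbelianization_mulEquiv_of_path p
  obtain ⟨e'⟩ := h.nonempty_mulEquiv_pi
  have e'' := fun n => (nonempty_strongAbelianization_mulEquiv_of_path
    ((hX n).somePath (x n) (y n))).some
  exact ⟨(e.trans e').trans (MulEquiv.piCongrRight e'')⟩

end IsShrinkingWedge
end Wedges

/-! ### The metric shrinking wedge satisfies the axioms -/

section SigmaRetraction

variable {X : ℕ → Type u} (x : ∀ n, X n)

/-- The map collapsing all but the `n`-th space to the base point, on the disjoint union. -/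
def sigmaRetr (n : ℕ) (a : Σ n, X n) : X n :=
  if h : a.1 = n then h ▸ a.2 else x n

theorem sigmaRetr_same (n : ℕ) (y : X n) : sigmaRetr x n ⟨n, y⟩ = y := by
  simp [sigmaRetr]

theorem sigmaRetr_ne {n m : ℕ} (h : n ≠ m) (y : X m) : sigmaRetr x n ⟨m, y⟩ = x n := by
  simp [sigmaRetr, h.symm]

theorem sigmaRetr_base (n m : ℕ) : sigmaRetr x n ⟨m, x m⟩ = x n := by
  by_cases h : n = m
  · subst h
    exact sigmaRetr_same x n _
  · exact sigmaRetr_ne x h _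

end SigmaRetraction

section ShrinkingWedgeMaps

variable {X : ℕ → Type u} [∀ n, TopologicalSpace (X n)] (x : ∀ n, X n)
  (d : ∀ n, CutoffMetric (X n) n)

/-- The metric space structure of a cutoff metric, with the given topology. -/
abbrev CutoffMetric.metricSpace {Y : Type u} [TopologicalSpace Y] {n : ℕ}
    (D : CutoffMetric Y n) : MetricSpace Y :=
  D.metric.replaceTopology D.topology_eq.symm

/-- The inclusion of the `n`-th space into the shrinking wedge. -/
def wedgeInclFun (n : ℕ) (y : X n) : ShrinkingWedge x d :=
  Quotient.mk (wedgeSetoid x) ⟨n, y⟩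

theorem dist_wedgeInclFun (n m : ℕ) (y : X n) (z : X m) :
    dist (wedgeInclFun x d n y) (wedgeInclFun x d m z) = sigmaDist x d ⟨n, y⟩ ⟨m, z⟩ := rfl

/-- The inclusion of the `n`-th space into the shrinking wedge, as a continuous map. -/
def wedgeIncl (n : ℕ) : C(X n, ShrinkingWedge x d) where
  toFun := wedgeInclFun x d n
  continuous_toFun := by
    let _ := (d n).metricSpace
    exact (Isometry.of_dist_eq fun y z => (dist_wedgeInclFun x d n n y z).trans
      (sigmaDist_same x d n y z)).continuous

theorem wedgeIncl_base (n m : ℕ) : wedgeIncl x d n (x n) = wedgeIncl x d m (x m) :=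
  Quotient.sound (s := wedgeSetoid x) (Or.inr ⟨rfl, rfl⟩)

theorem exists_wedgeIncl_eq (w : ShrinkingWedge x d) : ∃ n y, wedgeIncl x d n y = w := by
  obtain ⟨⟨n, y⟩⟩ := w
  exact ⟨n, y, rfl⟩

/-- The retraction of the shrinking wedge onto the `n`-th space. -/
def wedgeRetrFun (n : ℕ) : ShrinkingWedge x d → X n :=
  Quotient.lift (s := wedgeSetoid x) (sigmaRetr x n) (by
    rintro ⟨m, y⟩ ⟨k, z⟩ (h | ⟨h, h'⟩)
    · rw [h]
    · simp only at h h'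
      rw [h, h', sigmaRetr_base, sigmaRetr_base])

theorem dist_sigmaRetr_le (n : ℕ) (a b : Σ n, X n) :
    (d n).metric.dist (sigmaRetr x n a) (sigmaRetr x n b) ≤ sigmaDist x d a b := by
  obtain ⟨m, y⟩ := a
  obtain ⟨k, z⟩ := b
  by_cases hm : n = m <;> by_cases hk : n = k
  · subst hm hk
    rw [sigmaRetr_same, sigmaRetr_same, sigmaDist_same]
  · subst hm
    rw [sigmaRetr_same, sigmaRetr_ne x hk, sigmaDist_ne x d hk]
    linarith [cutoff_dist_nonneg d z (x k)]
  · subst hk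
    rw [sigmaRetr_same, sigmaRetr_ne x hm, sigmaDist_ne x d (Ne.symm hm), cutoff_dist_comm]
    linarith [cutoff_dist_nonneg d y (x m)]
  · rw [sigmaRetr_ne x hm, sigmaRetr_ne x hk, cutoff_dist_self]
    exact dist_nonneg (x := wedgeInclFun x d m y) (y := wedgeInclFun x d k z)

/-- The retraction of the shrinking wedge onto the `n`-th space, as a continuous map. -/
def wedgeRetr (n : ℕ) : C(ShrinkingWedge x d, X n) where
  toFun := wedgeRetrFun x d n
  continuous_toFun := by
    let _ := (d n).metricSpace
    refine (LipschitzWith.of_dist_le_mul (K := 1) ?_).continuous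
    rintro ⟨a⟩ ⟨b⟩
    rw [NNReal.coe_one, one_mul]
    exact dist_sigmaRetr_le x d n a b

theorem isShrinkingWedge_shrinkingWedge :
    IsShrinkingWedge (wedgeIncl x d 0 (x 0)) x (wedgeIncl x d) (wedgeRetr x d) where
  incl_base n := wedgeIncl_base x d n 0
  retr_incl n y := sigmaRetr_same x n y
  retr_incl_of_ne _ _ hmn y := sigmaRetr_ne x hmn y
  exists_incl_eq := exists_wedgeIncl_eq x d
  dist_lt ε hε := by
    obtain ⟨N, hN⟩ := exists_pow_lt_of_lt_one hε (y := (2 : ℝ)⁻¹) (by norm_num)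
    refine ⟨N, fun n hn y => ?_⟩
    rw [wedgeIncl_base x d 0 n]
    refine lt_of_eq_of_lt ((dist_wedgeInclFun x d n n _ _).trans (sigmaDist_same x d n _ _)) ?_
    exact ((d n).dist_le _ _).trans_lt
      ((pow_le_pow_of_le_one (by norm_num) (by norm_num) hn).trans_lt hN)

end ShrinkingWedgeMaps

/-! ### Strong abelianization of the circle -/

section CircleGroup

theorem exp_comp_liftPath (l : Path (1 : Circle) 1) (t : unitInterval) :
    Circle.exp (Circle.isCoveringMap_exp.liftPath l.toContinuousMap 0 (by simp) t) = l t :=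
  congrFun (Circle.isCoveringMap_exp.liftPath_lifts l.toContinuousMap 0 (by simp)) t

/-- Lifts of null-homotopic loops along the covering `Circle.exp` close up; conversely a closed lift
contracts in $\mathbb R$. -/
theorem loopClass_circle_eq_one_iff (l : Path (1 : Circle) 1) :
    loopClass l = 1 ↔ ∃ θ : C(unitInterval, ℝ), (∀ t, Circle.exp (θ t) = l t) ∧ θ 0 = θ 1 := by
  constructor
  · intro h
    have h1 : l.Homotopic (Path.refl 1) := Path.Homotopic.Quotient.exact h
    have h0 := Circle.isCoveringMap_exp.liftPath_apply_one_eq_of_homotopicRel h1 0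
      (by simp) (by simp)
    refine ⟨Circle.isCoveringMap_exp.liftPath l.toContinuousMap 0 (by simp),
      exp_comp_liftPath l, ?_⟩
    rw [Circle.isCoveringMap_exp.liftPath_zero]
    refine Eq.trans ?_ h0.symm
    have := Circle.isCoveringMap_exp.liftPath_const (x := (1 : Circle)) (e := 0) (by simp)
    exact (congrArg (fun f : C(unitInterval, ℝ) => f 1) this).symm
  · rintro ⟨θ, hθ, h01⟩
    let p : Path (θ 0) (θ 0) := ⟨θ, rfl, h01.symm⟩
    have hp : p.Homotopic (Path.refl (θ 0)) := SimplyConnectedSpace.paths_homotopic p _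
    have h0 : Circle.exp (θ 0) = 1 := (hθ 0).trans l.source
    have hl : l = mapLoop Circle.exp h0 p := by
      ext t
      rw [mapLoop_apply]
      exact congrArg _ (hθ t).symm
    rw [hl, ← mapOfEq_loopClass, loopClass_eq hp, loopClass_refl, map_one]

/-- If `p` is null-homotopic and `l` is within distance 1 of it, then $l/p$ stays within 1 of the
point 1, hence in the slit plane. Adding $\arg(l/p)$ to an angle function of `p` gives one for `l`
with equal end values. -/
theorem isClosedSubgroup_bot_circle :
    IsClosedSubgroup (⊥ : Subgroup (FundamentalGroup Circle 1)) := by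
  refine isClosed_of_closure_subset fun l hl => ?_
  have hev : ∀ᶠ p : Path (1 : Circle) 1 in 𝓝 l, ∀ t, dist (l t) (p t) < 1 :=
    tendsto_path_iff.1 (Filter.tendsto_id (x := 𝓝 l)) 1 one_pos
  obtain ⟨p, hp, hpl⟩ := mem_closure_iff_nhds.1 hl _ hev
  rw [mem_loopsOf, Subgroup.mem_bot] at hpl ⊢
  rw [loopClass_circle_eq_one_iff] at hpl ⊢
  obtain ⟨θ, hθ, h01⟩ := hpl
  have hslit : ∀ t, ((l t / p t : Circle) : ℂ) ∈ Complex.slitPlane := by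
    intro t
    have h1 : dist (l t : ℂ) (p t) < 1 := hp t
    rw [dist_eq_norm] at h1
    rw [← add_sub_cancel (1 : ℂ) ((l t / p t : Circle) : ℂ)]
    refine Complex.mem_slitPlane_of_norm_lt_one ?_
    have : ((l t / p t : Circle) : ℂ) - 1 = ((l t : ℂ) - p t) / p t := by
      rw [Circle.coe_div, sub_div, div_self (Circle.coe_ne_zero _)]
    rw [this, norm_div, Circle.norm_coe, div_one]
    exact h1
  refine ⟨⟨fun t => θ t + Complex.arg ((l t / p t : Circle) : ℂ), ?_⟩, fun t => ?_, ?_⟩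
  · refine θ.continuous.add (continuous_iff_continuousAt.2 fun t => ?_)
    exact (Complex.continuousAt_arg (hslit t)).comp
      (f := fun t => ((l t / p t : Circle) : ℂ)) (continuous_subtype_val.comp
        (l.continuous.div' p.continuous)).continuousAt
  · change Circle.exp (θ t + Complex.arg ((l t / p t : Circle) : ℂ)) = l t
    rw [Circle.exp_add, hθ, Circle.exp_arg, mul_div_cancel]
  · simp [h01]

theorem nonempty_fundamentalGroup_circle_mulEquiv :
    Nonempty (FundamentalGroup Circle 1 ≃* Multiplicative ℤ) := by
  have e1 := Circle.isAddQuotientCoveringMap_exp.fundamentalGroupEquiv (x := 1)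
    ⟨(0 : ℝ), by simp⟩
  have e2 : ℤ ≃+ AddSubgroup.zmultiples (2 * Real.pi) :=
    AddEquiv.ofBijective (zmultiplesHom ℝ (2 * Real.pi)).rangeRestrict
      ⟨AddMonoidHom.rangeRestrict_injective_iff.2
        (smul_left_injective ℤ Real.two_pi_pos.ne'), AddMonoidHom.rangeRestrict_surjective _⟩
  exact ⟨e1.trans (MulOpposite.opMulEquiv.symm.trans e2.symm.toMultiplicative)⟩

theorem nonempty_strongAbelianization_circle_mulEquiv :
    Nonempty (StrongAbelianization Circle 1 ≃* Multiplicative ℤ) := by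
  obtain ⟨e⟩ := nonempty_fundamentalGroup_circle_mulEquiv
  have hbot : closedCommutator Circle 1 = ⊥ := by
    refine le_bot_iff.1 (closedHull_le ?_ isClosedSubgroup_bot_circle)
    have : commutator (FundamentalGroup Circle 1) ≤ e.toMonoidHom.ker :=
      Abelianization.commutator_subset_ker e.toMonoidHom
    rwa [(MonoidHom.ker_eq_bot_iff e.toMonoidHom).2 e.injective] at this
  exact ⟨((QuotientGroup.quotientMulEquivOfEq hbot).trans QuotientGroup.quotientBot).trans e⟩

end CircleGroup

/-! ### The Hawaiian earring satisfies the axioms -/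

section Earring

theorem mem_sphere_iff_of_pos {c : ℝ} (hc : 0 < c) (p : EuclideanSpace ℝ (Fin 2)) :
    p ∈ Metric.sphere !₂[(0 : ℝ), c] c ↔ p 0 ^ 2 + p 1 ^ 2 = 2 * c * p 1 := by
  rw [mem_sphere_iff_norm, EuclideanSpace.norm_eq, Real.sqrt_eq_iff_eq_sq (by positivity) hc.le]
  simp only [Real.norm_eq_abs, sq_abs, Fin.sum_univ_two, PiLp.sub_apply, Matrix.cons_val_zero,
    Matrix.cons_val_one, sub_zero]
  constructor <;> intro h <;> linarith

/-- The radius of the `n`-th circle of the Hawaiian earring. -/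
def earringRadius (n : ℕ) : ℝ := 1 / ((n : ℝ) + 2)

theorem earringRadius_pos (n : ℕ) : 0 < earringRadius n := by
  unfold earringRadius
  positivity

theorem mem_earring_circle_iff (n : ℕ) (p : EuclideanSpace ℝ (Fin 2)) :
    p ∈ Metric.sphere !₂[(0 : ℝ), earringRadius n] (earringRadius n) ↔
      ((n : ℝ) + 2) * (p 0 ^ 2 + p 1 ^ 2) = 2 * p 1 := by
  rw [mem_sphere_iff_of_pos (earringRadius_pos n), earringRadius]
  have h : (n : ℝ) + 2 ≠ 0 := by positivity
  field_simp

theorem zero_mem_earring_circle (n : ℕ) :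
    (0 : EuclideanSpace ℝ (Fin 2)) ∈
      Metric.sphere !₂[(0 : ℝ), earringRadius n] (earringRadius n) :=
  (mem_earring_circle_iff n 0).2 (by simp)

theorem mem_hawaiianEarring_iff (p : EuclideanSpace ℝ (Fin 2)) :
    p ∈ hawaiianEarring ↔ ∃ n : ℕ, ((n : ℝ) + 2) * (p 0 ^ 2 + p 1 ^ 2) = 2 * p 1 := by
  simp only [← mem_earring_circle_iff]
  exact Set.mem_iUnion

theorem circle_re_sq_add_im_sq (z : Circle) : (z : ℂ).re ^ 2 + (z : ℂ).im ^ 2 = 1 := by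
  have := Circle.normSq_coe z
  rw [Complex.normSq_apply] at this
  linarith

/-- The point of the `n`-th circle of the Hawaiian earring corresponding to `z`, where `1`
corresponds to the base point. -/
def earringPoint (n : ℕ) (z : Circle) : EuclideanSpace ℝ (Fin 2) :=
  !₂[earringRadius n * (z : ℂ).im, earringRadius n * (1 - (z : ℂ).re)]

theorem earringPoint_zero (n : ℕ) (z : Circle) :
    earringPoint n z 0 = earringRadius n * (z : ℂ).im := rfl

theorem earringPoint_one (n : ℕ) (z : Circle) :
    earringPoint n z 1 = earringRadius n * (1 - (z : ℂ).re) := rfl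

theorem earringPoint_mem (n : ℕ) (z : Circle) :
    ((n : ℝ) + 2) * (earringPoint n z 0 ^ 2 + earringPoint n z 1 ^ 2) =
      2 * earringPoint n z 1 := by
  have h := circle_re_sq_add_im_sq z
  have hn : (n : ℝ) + 2 ≠ 0 := by positivity
  simp only [earringPoint_zero, earringPoint_one, earringRadius]
  field_simp
  linarith

/-- The inclusion of the `n`-th circle into the Hawaiian earring. -/
def earringIncl (n : ℕ) : C(Circle, hawaiianEarring) where
  toFun z := ⟨earringPoint n z, (mem_hawaiianEarring_iff _).2 ⟨n, earringPoint_mem n z⟩⟩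
  continuous_toFun := by
    refine Continuous.subtype_mk ((PiLp.continuous_toLp 2 _).comp (continuous_pi fun k => ?_)) _
    have h : Continuous fun z : Circle => (z : ℂ) := continuous_subtype_val
    fin_cases k
    · exact continuous_const.mul (Complex.continuous_im.comp h)
    · exact continuous_const.mul (continuous_const.sub (Complex.continuous_re.comp h))

/-- The complex number corresponding to a point of the `n`-th circle of the Hawaiian earring. -/
def earringCoord (n : ℕ) (p : EuclideanSpace ℝ (Fin 2)) : ℂ :=
  ⟨1 - ((n : ℝ) + 2) * p 1, ((n : ℝ) + 2) * p 0⟩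

theorem continuous_earringCoord (n : ℕ) : Continuous (earringCoord n) := by
  have h : earringCoord n = fun p => Complex.equivRealProdCLM.symm
      (1 - ((n : ℝ) + 2) * p 1, ((n : ℝ) + 2) * p 0) := rfl
  rw [h]
  fun_prop

theorem earringCoord_point (n : ℕ) (z : Circle) : earringCoord n (earringPoint n z) = z := by
  have hn : (n : ℝ) + 2 ≠ 0 := by positivity
  apply Complex.ext
  · simp only [earringCoord, earringPoint_one, earringRadius]
    field_simp
    ring
  · simp only [earringCoord, earringPoint_zero, earringRadius]
    field_simp

theorem earringPoint_coord (n : ℕ) {p : EuclideanSpace ℝ (Fin 2)} {z : Circle}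
    (hz : (z : ℂ) = earringCoord n p) : earringPoint n z = p := by
  have hn : (n : ℝ) + 2 ≠ 0 := by positivity
  ext k
  simp only [earringPoint, hz, earringCoord, earringRadius]
  fin_cases k
  · simp
    field_simp
  · simp
    field_simp

theorem norm_earringCoord {n : ℕ} {p : EuclideanSpace ℝ (Fin 2)}
    (hp : ((n : ℝ) + 2) * (p 0 ^ 2 + p 1 ^ 2) = 2 * p 1) : ‖earringCoord n p‖ = 1 := by
  rw [← sq_eq_sq₀ (norm_nonneg _) zero_le_one, ← Complex.normSq_eq_norm_sq, Complex.normSq_apply]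
  simp only [earringCoord]
  linear_combination ((n : ℝ) + 2) * hp

/-- The `n`-th circle, as a subset of the Hawaiian earring. -/
def earringCircle (n : ℕ) : Set hawaiianEarring :=
  {p | ((n : ℝ) + 2) * (p.1 0 ^ 2 + p.1 1 ^ 2) = 2 * p.1 1}

/-- The union of the circles other than the `n`-th one, as a subset of the Hawaiian earring. -/
def earringRest (n : ℕ) : Set hawaiianEarring :=
  {p | 2 * p.1 1 ≤ ((n : ℝ) + 3 / 2) * (p.1 0 ^ 2 + p.1 1 ^ 2) ∨
    ((n : ℝ) + 5 / 2) * (p.1 0 ^ 2 + p.1 1 ^ 2) ≤ 2 * p.1 1}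

theorem isClosed_earringCircle (n : ℕ) : IsClosed (earringCircle n) :=
  isClosed_eq (by fun_prop) (by fun_prop)

theorem isClosed_earringRest (n : ℕ) : IsClosed (earringRest n) := by
  have h1 : IsClosed {p : hawaiianEarring |
      2 * p.1 1 ≤ ((n : ℝ) + 3 / 2) * (p.1 0 ^ 2 + p.1 1 ^ 2)} :=
    isClosed_le (by fun_prop) (by fun_prop)
  have h2 : IsClosed {p : hawaiianEarring |
      ((n : ℝ) + 5 / 2) * (p.1 0 ^ 2 + p.1 1 ^ 2) ≤ 2 * p.1 1} :=
    isClosed_le (by fun_prop) (by fun_prop)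
  exact h1.union h2

/-- Away from the origin $2p_1/|p|^2$ equals $m+2$ on the `m`-th circle; the thresholds $n+3/2$ and
$n+5/2$ separate $n+2$ from the other integers by closed conditions. -/
theorem mem_earringRest {m n : ℕ} (hmn : m ≠ n) {p : hawaiianEarring}
    (hp : p ∈ earringCircle m) : p ∈ earringRest n := by
  have hp' : ((m : ℝ) + 2) * (p.1 0 ^ 2 + p.1 1 ^ 2) = 2 * p.1 1 := hp
  have h0 : 0 ≤ p.1 0 ^ 2 + p.1 1 ^ 2 := by positivity
  rcases hmn.lt_or_gt with h | h
  · left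
    rw [← hp']
    have : (m : ℝ) + 1 ≤ n := by exact_mod_cast h
    exact mul_le_mul_of_nonneg_right (by linarith) h0
  · right
    rw [← hp']
    have : (n : ℝ) + 1 ≤ m := by exact_mod_cast h
    exact mul_le_mul_of_nonneg_right (by linarith) h0

theorem mem_circle_or_mem_rest (n : ℕ) (p : hawaiianEarring) :
    p ∈ earringCircle n ∨ p ∈ earringRest n := by
  obtain ⟨m, hm⟩ := (mem_hawaiianEarring_iff p.1).1 p.2
  by_cases hmn : m = n
  · subst hmn
    exact Or.inl hm
  · exact Or.inr (mem_earringRest hmn hm)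

theorem earringCoord_eq_one {n : ℕ} {p : hawaiianEarring} (hp : p ∈ earringCircle n)
    (hp' : p ∈ earringRest n) : earringCoord n p.1 = 1 := by
  have h : ((n : ℝ) + 2) * (p.1 0 ^ 2 + p.1 1 ^ 2) = 2 * p.1 1 := hp
  have h0 : p.1 0 ^ 2 + p.1 1 ^ 2 ≤ 0 := by
    rcases hp' with h' | h' <;> linarith
  have h1 : p.1 0 = 0 := by nlinarith [sq_nonneg (p.1 0), sq_nonneg (p.1 1)]
  have h2 : p.1 1 = 0 := by nlinarith [sq_nonneg (p.1 0), sq_nonneg (p.1 1)]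
  apply Complex.ext <;> simp [earringCoord, h1, h2]

open Classical in
/-- The retraction of the Hawaiian earring onto its `n`-th circle. -/
def earringRetr (n : ℕ) : C(hawaiianEarring, Circle) where
  toFun p := ⟨if p ∈ earringCircle n then earringCoord n p.1 else 1,
    mem_sphere_zero_iff_norm.2 (by
      split_ifs with h
      · exact norm_earringCoord h
      · exact norm_one)⟩
  continuous_toFun := Continuous.subtype_mk (continuous_ite_of_isClosed
    ((continuous_earringCoord n).comp continuous_subtype_val) continuous_const
    (isClosed_earringCircle n) (isClosed_earringRest n) (mem_circle_or_mem_rest n)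
    (fun _ => earringCoord_eq_one)) _

theorem coe_earringRetr_of_mem {n : ℕ} {p : hawaiianEarring} (hp : p ∈ earringCircle n) :
    (earringRetr n p : ℂ) = earringCoord n p.1 :=
  if_pos hp

theorem earringRetr_of_mem_rest {n : ℕ} {p : hawaiianEarring} (hp : p ∈ earringRest n) :
    earringRetr n p = 1 := by
  apply Circle.ext
  by_cases h : p ∈ earringCircle n
  · rw [coe_earringRetr_of_mem h, earringCoord_eq_one h hp, Circle.coe_one]
  · exact if_neg h

theorem earringIncl_mem (n : ℕ) (z : Circle) : earringIncl n z ∈ earringCircle n :=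
  earringPoint_mem n z

theorem isShrinkingWedge_hawaiianEarring :
    IsShrinkingWedge (⟨0, (mem_hawaiianEarring_iff _).2 ⟨0, by simp⟩⟩ : hawaiianEarring)
      (fun _ => (1 : Circle)) earringIncl earringRetr where
  incl_base n := by
    apply Subtype.ext
    ext k
    fin_cases k <;> simp [earringIncl, earringPoint]
  retr_incl n z := Circle.ext
    ((coe_earringRetr_of_mem (earringIncl_mem n z)).trans (earringCoord_point n z))
  retr_incl_of_ne m n hmn z :=
    earringRetr_of_mem_rest (mem_earringRest hmn.symm (earringIncl_mem n z))
  exists_incl_eq p := by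
    obtain ⟨n, hn⟩ := (mem_hawaiianEarring_iff p.1).1 p.2
    exact ⟨n, earringRetr n p, Subtype.ext (earringPoint_coord n (coe_earringRetr_of_mem hn))⟩
  dist_lt ε hε := by
    -- The `n`-th circle has diameter $2/(n+2)$.
    obtain ⟨N, hN⟩ := exists_nat_gt (2 / ε)
    refine ⟨N, fun n hn z => ?_⟩
    have h1 : dist (0 : EuclideanSpace ℝ (Fin 2)) _ = _ := zero_mem_earring_circle n
    have h2 : dist (earringPoint n z) _ = _ := (mem_earring_circle_iff n _).2 (earringPoint_mem n z)
    rw [dist_comm] at h2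
    have h3 : dist (0 : EuclideanSpace ℝ (Fin 2)) (earringPoint n z) ≤
        earringRadius n + earringRadius n := (dist_triangle _ _ _).trans_eq (by rw [h1, h2])
    have h4 : earringRadius n + earringRadius n < ε := by
      have hn' : (N : ℝ) ≤ n := by exact_mod_cast hn
      rw [earringRadius, ← add_div, div_lt_iff₀ (by positivity)]
      rw [div_lt_iff₀ hε] at hN
      nlinarith
    exact h3.trans_lt h4

end Earring

end StrongAb

end

theorem mainTheorem9 :
    (∀ (X : ℕ → Type u) [∀ n, TopologicalSpace (X n)]
        [∀ n, TopologicalSpace.MetrizableSpace (X n)] [∀ n, PathConnectedSpace (X n)]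
        (x : ∀ n, X n) (d : ∀ n, StrongAb.CutoffMetric (X n) n)
        (z : StrongAb.ShrinkingWedge x d) (y : ∀ n, X n),
        Nonempty (StrongAb.StrongAbelianization (StrongAb.ShrinkingWedge x d) z ≃*
          ∀ n, StrongAb.StrongAbelianization (X n) (y n))) ∧
      ∀ z : StrongAb.hawaiianEarring,
        Nonempty (StrongAb.StrongAbelianization StrongAb.hawaiianEarring z ≃*
          (ℕ → Multiplicative ℤ)) := by
  refine ⟨fun X _ _ hX x d z y => (StrongAb.isShrinkingWedge_shrinkingWedge x d)
    |>.nonempty_mulEquiv_pi_of_pathConnected hX z y, fun z => ?_⟩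
  obtain ⟨e⟩ := StrongAb.nonempty_strongAbelianization_circle_mulEquiv
  obtain ⟨e'⟩ := StrongAb.isShrinkingWedge_hawaiianEarring.nonempty_mulEquiv_pi_of_pathConnected
    (fun _ => inferInstance) z (fun _ => 1)
  exact ⟨e'.trans (MulEquiv.piCongrRight fun _ => e)⟩
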